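/- Let $(E,\mathcal E)$ be a Borel space (a standard Borel measurable space), let $\alpha$ be a finite measure on $E$ and let $p\in(0,1)$. Let $\mathbf N_{<\infty}$ be the space of finite counting measures on $E$, that is, finite measures $\eta$ with $\eta(B)\in\mathbb N_0$ for all $B\in\mathcal E$, equipped with the $\sigma$-algebra generated by the maps $\eta\mapsto\eta(B)$, $B\in\mathcal E$. Write $(a)^{(k)}=a(a+1)\cdots(a+k-1)$ and $(x)_k=x(x-1)\cdots(x-k+1)$, with $(a)^{(0)}=(x)_0=1$. Let $\rho$ be the Pascal distribution with parameters $\alpha$ and $p$, i.e. the probability measure on $\mathbf N_{<\infty}$ under which $\eta(B_1),\dots,\eta(B_m)$ are independent whenever $B_1,\dots,B_m\in\mathcal E$ are pairwise disjoint, and $$\rho(\eta(B)=k)=(1-p)^{\alpha(B)}\,(\alpha(B))^{(k)}\,\frac{p^k}{k!},\qquad B\in\mathcal E,\ k\in\mathbb N_0 .$$ For $n\in\mathbb N_0$ let $\mathcal P_{n-1}\subset L^2(\rho)$ be the space of linear combinations of the maps $\eta\mapsto\int f\,\mathrm d\eta^{\otimes k}$ with $0\le k\le n-1$ and $f:E^k\to\mathbb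 R$ bounded and measurable (for $k=0$ these are the constants; $\mathcal P_{-1}=\{0\}$). For bounded measurable $f:E^n\to\mathbb R$ let $I_n(f,\cdot)$ be the orthogonal projection in $L^2(\rho)$ of $\eta\mapsto\int f\,\mathrm d\eta^{\otimes n}$ onto $\overline{\mathcal P_{n-1}}^{\perp}$. For $n\in\mathbb N_0$ and $a\ge 0$ let $$\mathscr M_n(x;a;p)=\sum_{k=0}^n\binom nk\Bigl(1-\frac1p\Bigr)^{k-n}(a+k)^{(n-k)}(x)_k$$ be the monic Meixner polynomials. Then for all $N\in\mathbb N$, all pairwise disjoint $B_1,\dots,B_N\in\mathcal E$ and all $d_1,\dots,d_N\in\mathbb N_0$, with $n=d_1+\dots+d_N$, the map $\eta\mapsto\int \mathbf 1_{B_1}^{\otimes d_1}\otimes\cdots\otimes\mathbf 1_{B_N}^{\otimes d_N}\,\mathrm d\eta^{\otimes n}$ belongs to $L^2(\rho)$ and $$I_n\bigl(\mathbf 1_{B_1}^{\otimes d_1}\otimes\cdots\otimes\mathbf 1_{B_N}^{\otimes d_N},\eta\bigr)=\prod_{k=1}^N\mathscr M_{d_k}\bigl(\eta(B_k);\alpha(B_k);p\bigr)\qquad\text{for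 }\rho\text{-almost every }\eta .$$ -/

import Mathlib

open MeasureTheory ProbabilityTheory

noncomputable section

namespace PascalMeixner

/-- The space of finite counting measures on `E`: finite measures with values in `ℕ` on every
measurable set. -/
structure Conf (E : Type*) [MeasurableSpace E] where
  meas : Measure E
  isFinite : IsFiniteMeasure meas
  isCount : ∀ B, MeasurableSet B → ∃ k : ℕ, meas B = k

variable {E : Type*} [MeasurableSpace E]

/-- The σ-algebra generated by the counting variables `η ↦ η B`, `B` measurable. -/
instance : MeasurableSpace (Conf E) :=
  ⨆ (B : Set E) (_ : MeasurableSet B),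
    MeasurableSpace.comap (fun η : Conf E => η.meas B) inferInstance

instance (η : Conf E) : IsFiniteMeasure η.meas := η.isFinite

/-- The mass that the negative binomial law with parameters `a` and `p` gives to `k`. -/
def negBinomial (a p : ℝ) (k : ℕ) : ℝ :=
  (ascPochhammer ℝ k).eval a * (p ^ k / (k.factorial : ℝ)) * (1 - p) ^ a

/-- `ρ` is the Pascal distribution with parameters `α` and `p`: under `ρ`, counts in disjoint
regions are independent and the count in each region is negative binomial. -/
structure IsPascal (α : Measure E) (p : ℝ) (ρ : Measure (Conf E)) : Prop where
  indep : ∀ (m : ℕ) (B : Fin m → Set E), (∀ i, MeasurableSet (B i)) →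
    Pairwise (Function.onFun Disjoint B) → iIndepFun (fun i (η : Conf E) => η.meas (B i)) ρ
  law : ∀ B : Set E, MeasurableSet B → ∀ k : ℕ,
    ρ {η : Conf E | η.meas B = k} = ENNReal.ofReal (negBinomial (α.real B) p k)

/-- The monomial `η ↦ ∫ f dη^{⊗n}`; for `n = 0` it is the constant given by the only value
of `f`. -/
def monomial {n : ℕ} (f : (Fin n → E) → ℝ) (η : Conf E) : ℝ :=
  ∫ x, f x ∂(Measure.pi fun _ : Fin n => η.meas)

variable (E) in
/-- Generalized polynomials of degree strictly less than `n`: linear combinations of monomials of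
degree `k < n` with bounded measurable coefficients (only `0` if `n = 0`). -/
def polyDegLT (n : ℕ) : Submodule ℝ (Conf E → ℝ) :=
  Submodule.span ℝ {q | ∃ k < n, ∃ f : (Fin k → E) → ℝ,
    Measurable f ∧ (∃ C : ℝ, ∀ x, |f x| ≤ C) ∧ q = monomial f}

/-- Generalized polynomials of degree strictly less than `n` as a subspace of `L²(ρ)`. -/
def polyL2 (ρ : Measure (Conf E)) (n : ℕ) : Submodule ℝ (Lp ℝ 2 ρ) where
  carrier := {F | ∃ q ∈ polyDegLT E n, F =ᵐ[ρ] q}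
  zero_mem' := ⟨0, Submodule.zero_mem _, Lp.coeFn_zero ℝ 2 ρ⟩
  add_mem' := by
    rintro F G ⟨q, hq, hFq⟩ ⟨r, hr, hGr⟩
    exact ⟨q + r, Submodule.add_mem _ hq hr, (Lp.coeFn_add F G).trans (hFq.add hGr)⟩
  smul_mem' := by
    rintro c F ⟨q, hq, hFq⟩
    exact ⟨c • q, Submodule.smul_mem _ c hq, (Lp.coeFn_smul c F).trans (hFq.const_smul c)⟩

/-- The generalized orthogonal polynomial `I_n(f)`: the orthogonal projection in `L²(ρ)` of the
monomial `η ↦ η^{⊗n}(f)` onto the orthogonal complement of the closure of the space of generalized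
polynomials of degree at most `n - 1`. -/
def genOrthPoly (ρ : Measure (Conf E)) {n : ℕ} (f : (Fin n → E) → ℝ)
    (hf : MemLp (monomial f) 2 ρ) : Lp ℝ 2 ρ :=
  ((polyL2 ρ n).topologicalClosure)ᗮ.starProjection (hf.toLp (monomial f))

/-- The monic Meixner polynomial of degree `n` with parameters `a`, `p`, evaluated at `x`. -/
def meixner (n : ℕ) (x a p : ℝ) : ℝ :=
  ∑ k ∈ Finset.range (n + 1), (n.choose k : ℝ) * (1 - 1 / p) ^ ((k : ℤ) - (n : ℤ)) *
    (ascPochhammer ℝ (n - k)).eval (a + k) * (descPochhammer ℝ k).eval x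

/-- The function `1_{B_1}^{⊗d_1} ⊗ ⋯ ⊗ 1_{B_N}^{⊗d_N}` on `E^(d_1 + ⋯ + d_N)`; the coordinates are
grouped into consecutive blocks of lengths `d_1, …, d_N`. -/
def tensorIndicator {N : ℕ} (B : Fin N → Set E) (d : Fin N → ℕ) (x : Fin (∑ k, d k) → E) : ℝ :=
  ∏ k, ∏ j : Fin (d k), (B k).indicator (fun _ => (1 : ℝ)) (x (finSigmaFinEquiv ⟨k, j⟩))

end PascalMeixner

end

/-!
The generating series `∑ M_n(x; a; p) X^n / n!` equals `(1 - q X)^(-a) (1 + X / (1 - q X))^x` with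
`q = p / (p - 1)`, so it is multiplicative in `(a, x)`. This gives an addition theorem: if `B` is
split into finitely many pieces, `M_n(η B; α B; p)` becomes a combination of products of Meixner
polynomials of the counts in the pieces, with degrees adding up to `n`.

To see that `∏ M_{d_k}(η B_k; α B_k; p)` is orthogonal to every monomial of degree `m < n`, it
suffices by a π-λ argument to test against products `η A_1 ⋯ η A_m`. Pass to a finite measurable
partition that refines all the sets `A_j` and `B_k`. By independence the integral factorizes over
the pieces, and on some piece a Meixner polynomial is paired with a monomial of smaller degree.
That factor vanishes: pairing `M_n` with the rising factorial `(a + x)^(f)` under the negative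
binomial law produces an `n`-th finite difference of a polynomial of degree `f < n`.

Since the Meixner polynomials are monic, the product differs from `∏ (η B_k)^(d_k)` by terms of
lower degree, and is therefore the projection.
-/

open scoped PowerSeries Polynomial

noncomputable section

namespace PascalMeixner

/-! ### Rising factorials -/

lemma ascPochhammer_add_eval {S : Type*} [CommSemiring S] (m n : ℕ) (a : S) :
    (ascPochhammer S (m + n)).eval a =
      (ascPochhammer S m).eval a * (ascPochhammer S n).eval (a + m) := by
  simp [← ascPochhammer_mul, Polynomial.eval_comp]

lemma pow_le_ascPochhammer_eval {a : ℝ} (ha : 0 ≤ a) (n : ℕ) :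
    a ^ n ≤ (ascPochhammer ℝ n).eval a := by
  induction n with
  | zero => simp
  | succ n ih =>
    rw [ascPochhammer_succ_eval, pow_succ]
    exact mul_le_mul ih (le_add_of_nonneg_right n.cast_nonneg) ha ((pow_nonneg ha n).trans ih)

lemma ascPochhammer_eval_nonneg {a : ℝ} (ha : 0 ≤ a) (n : ℕ) :
    0 ≤ (ascPochhammer ℝ n).eval a :=
  (pow_nonneg ha n).trans (pow_le_ascPochhammer_eval ha n)

lemma multichoose_eq_ascPochhammer_div (a : ℝ) (n : ℕ) :
    Ring.multichoose a n = (ascPochhammer ℝ n).eval a / n.factorial := by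
  rw [eq_div_iff (by positivity), ← Polynomial.ascPochhammer_smeval_eq_eval,
    ← Ring.factorial_nsmul_multichoose_eq_ascPochhammer, nsmul_eq_mul, mul_comm]

lemma hasSum_ascPochhammer_mul_pow_div (a : ℝ) {p : ℝ} (hp : |p| < 1) :
    HasSum (fun n : ℕ => (ascPochhammer ℝ n).eval a * (p ^ n / n.factorial))
      ((1 - p) ^ (-a)) := by
  have h := (Real.one_div_one_sub_rpow_hasFPowerSeriesOnBall_zero a).hasSum (y := p)
    (by simpa [enorm_eq_nnnorm, ← NNReal.coe_lt_coe] using hp)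
  rw [zero_add, one_div, ← Real.rpow_neg (by linarith [(abs_lt.1 hp).2])] at h
  convert! h using 2 with n
  rw [FormalMultilinearSeries.ofScalars_apply_eq, ← Ring.multichoose_eq,
    multichoose_eq_ascPochhammer_div, smul_eq_mul]
  ring

/-! ### Generating series of the Meixner polynomials -/

/-- The formal power series of `(1 - q X) ^ (-a)`, whose coefficients are rising factorials. -/
def risingSeries (q a : ℝ) : ℝ⟦X⟧ :=
  PowerSeries.rescale (-q) (PowerSeries.binomialSeries ℝ (-a))

lemma coeff_risingSeries (q a : ℝ) (n : ℕ) :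
    PowerSeries.coeff n (risingSeries q a) = q ^ n * (ascPochhammer ℝ n).eval a / n.factorial := by
  rw [risingSeries, PowerSeries.coeff_rescale, PowerSeries.binomialSeries_coeff, Ring.choose_neg,
    ← Ring.multichoose_eq, multichoose_eq_ascPochhammer_div, Units.smul_def, zsmul_eq_mul, neg_pow]
  rcases neg_one_pow_eq_or ℝ n with h | h <;> simp [h, mul_div_assoc]

lemma risingSeries_zero (q : ℝ) : risingSeries q 0 = 1 := by
  simp [risingSeries]

lemma risingSeries_add (q a b : ℝ) :
    risingSeries q (a + b) = risingSeries q a * risingSeries q b := by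
  simp only [risingSeries, neg_add, PowerSeries.binomialSeries_add, map_mul]

lemma risingSeries_add_natCast (q a : ℝ) (k : ℕ) :
    risingSeries q (a + k) = risingSeries q a * risingSeries q 1 ^ k := by
  induction k with
  | zero => simp
  | succ k ih => rw [Nat.cast_succ, ← add_assoc, risingSeries_add, ih, pow_succ, mul_assoc]

lemma hasSubst_X_mul {R : Type*} [CommRing R] (r : R⟦X⟧) :
    PowerSeries.HasSubst (PowerSeries.X * r) :=
  .of_constantCoeff_zero' (by simp)

lemma coeff_mul_subst_X_mul {R : Type*} [CommRing R] (g r f : R⟦X⟧) (n : ℕ) :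
    PowerSeries.coeff n (g * f.subst (PowerSeries.X * r)) =
      ∑ k ∈ Finset.range (n + 1),
        PowerSeries.coeff k f * PowerSeries.coeff (n - k) (g * r ^ k) := by
  have hcoeff (k : ℕ) (s : R⟦X⟧) : PowerSeries.coeff n (g * ((PowerSeries.X * r) ^ k * s)) =
      if k ≤ n then PowerSeries.coeff (n - k) (g * r ^ k * s) else 0 := by
    rw [mul_pow, mul_assoc, mul_left_comm, PowerSeries.coeff_X_pow_mul', mul_assoc]
  conv_lhs => rw [PowerSeries.eq_X_pow_mul_shift_add_trunc (n + 1) f]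
  rw [PowerSeries.subst_add (hasSubst_X_mul r), PowerSeries.subst_mul (hasSubst_X_mul r),
    PowerSeries.subst_pow (hasSubst_X_mul r), PowerSeries.subst_X (hasSubst_X_mul r),
    PowerSeries.subst_coe (hasSubst_X_mul r), Polynomial.aeval_def,
    PowerSeries.eval₂_trunc_eq_sum_range, mul_add, map_add, hcoeff, if_neg (by omega), zero_add,
    Finset.mul_sum, map_sum]
  refine Finset.sum_congr rfl fun k hk => ?_
  rw [mul_comm (algebraMap R R⟦X⟧ _), hcoeff, if_pos (Finset.mem_range_succ_iff.1 hk),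
    PowerSeries.algebraMap_apply, Algebra.algebraMap_self_apply, PowerSeries.coeff_mul_C, mul_comm]

/-- The exponential generating series `∑ M_n(x; a; p) X ^ n / n!`, where `q = p / (p - 1)`. -/
def meixnerSeries (q a x : ℝ) : ℝ⟦X⟧ :=
  risingSeries q a * (PowerSeries.binomialSeries ℝ x).subst (PowerSeries.X * risingSeries q 1)

lemma meixnerSeries_zero (q : ℝ) : meixnerSeries q 0 0 = 1 := by
  rw [meixnerSeries, risingSeries_zero, PowerSeries.binomialSeries_zero, one_mul,
    ← PowerSeries.coe_substAlgHom (hasSubst_X_mul _), map_one]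

lemma meixnerSeries_add (q a b x y : ℝ) :
    meixnerSeries q (a + b) (x + y) = meixnerSeries q a x * meixnerSeries q b y := by
  rw [meixnerSeries, risingSeries_add, PowerSeries.binomialSeries_add,
    PowerSeries.subst_mul (hasSubst_X_mul _), mul_mul_mul_comm, meixnerSeries, meixnerSeries]

lemma meixnerSeries_sum {ι : Type*} (s : Finset ι) (q : ℝ) (a x : ι → ℝ) :
    meixnerSeries q (∑ i ∈ s, a i) (∑ i ∈ s, x i) = ∏ i ∈ s, meixnerSeries q (a i) (x i) := by
  classical
  induction s using Finset.induction_on with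
  | empty => simp [meixnerSeries_zero]
  | insert i s hi ih =>
    rw [Finset.sum_insert hi, Finset.sum_insert hi, Finset.prod_insert hi, meixnerSeries_add, ih]

lemma meixner_eq_sum_inv_pow (n : ℕ) (x a p : ℝ) :
    meixner n x a p = ∑ k ∈ Finset.range (n + 1), (n.choose k : ℝ) * (1 - 1 / p)⁻¹ ^ (n - k) *
      (ascPochhammer ℝ (n - k)).eval (a + k) * (descPochhammer ℝ k).eval x := by
  refine Finset.sum_congr rfl fun k hk => ?_
  have hkn : k ≤ n := Finset.mem_range_succ_iff.1 hk
  rw [show (k : ℤ) - n = -((n - k : ℕ) : ℤ) by push_cast [hkn]; ring, zpow_neg, zpow_natCast,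
    inv_pow]

lemma coeff_meixnerSeries (n : ℕ) (a x p : ℝ) :
    PowerSeries.coeff n (meixnerSeries (1 - 1 / p)⁻¹ a x) = meixner n x a p / n.factorial := by
  rw [meixnerSeries, coeff_mul_subst_X_mul, meixner_eq_sum_inv_pow, Finset.sum_div]
  refine Finset.sum_congr rfl fun k hk => ?_
  have hchoose : Ring.choose x k = (descPochhammer ℝ k).eval x / k.factorial := by
    rw [Ring.choose_eq_smul, smul_eq_mul, inv_mul_eq_div, ← Polynomial.aeval_eq_smeval,
      ← Polynomial.eval_map_algebraMap, algebraMap_int_eq, descPochhammer_map]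
  rw [← risingSeries_add_natCast, coeff_risingSeries, PowerSeries.binomialSeries_coeff,
    smul_eq_mul, mul_one, hchoose, Nat.cast_choose ℝ (Finset.mem_range_succ_iff.1 hk)]
  field_simp

lemma meixner_sum {ι : Type*} [DecidableEq ι] (s : Finset ι) (n : ℕ) (p : ℝ) (a x : ι → ℝ) :
    meixner n (∑ i ∈ s, x i) (∑ i ∈ s, a i) p = n.factorial *
      ∑ l ∈ s.finsuppAntidiag n, ∏ i ∈ s, (meixner (l i) (x i) (a i) p / (l i).factorial) := by
  have h := coeff_meixnerSeries n (∑ i ∈ s, a i) (∑ i ∈ s, x i) p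
  simp only [meixnerSeries_sum, PowerSeries.coeff_prod, coeff_meixnerSeries] at h
  rw [h, mul_div_cancel₀ _ (by positivity)]

lemma prod_meixner_sum {ι U : Type*} [Fintype ι] [DecidableEq ι] [Fintype U] [DecidableEq U]
    (d : ι → ℕ) (p : ℝ) (a x : ι × U → ℝ) :
    ∏ i, meixner (d i) (∑ u, x (i, u)) (∑ u, a (i, u)) p =
      ∑ l ∈ Fintype.piFinset fun i => (Finset.univ : Finset U).finsuppAntidiag (d i),
        (∏ i, ((d i).factorial / ∏ u, ((l i u).factorial : ℝ))) *
          ∏ t : ι × U, meixner (l t.1 t.2) (x t) (a t) p := by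
  simp only [meixner_sum, Finset.prod_mul_distrib, Finset.prod_univ_sum, Finset.mul_sum,
    Fintype.prod_prod_type, Finset.prod_div_distrib]
  exact Finset.sum_congr rfl fun l _ => by ring

/-- The Meixner polynomial `x ↦ meixner n x a p` as an element of `ℝ[X]`, where its degree and
leading coefficient can be read off. -/
def meixnerPoly (n : ℕ) (a p : ℝ) : ℝ[X] :=
  ∑ k ∈ Finset.range (n + 1), Polynomial.C ((n.choose k : ℝ) * (1 - 1 / p)⁻¹ ^ (n - k) *
    (ascPochhammer ℝ (n - k)).eval (a + k)) * descPochhammer ℝ k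

lemma eval_meixnerPoly (n : ℕ) (x a p : ℝ) : (meixnerPoly n a p).eval x = meixner n x a p := by
  simp only [meixnerPoly, meixner_eq_sum_inv_pow, Polynomial.eval_finsetSum, Polynomial.eval_mul,
    Polynomial.eval_C]

lemma natDegree_meixnerPoly_le (n : ℕ) (a p : ℝ) : (meixnerPoly n a p).natDegree ≤ n :=
  Polynomial.natDegree_sum_le_of_forall_le _ _ fun k hk =>
    (Polynomial.natDegree_C_mul_le _ _).trans
      ((descPochhammer_natDegree ℝ k).trans_le (Finset.mem_range_succ_iff.1 hk))

lemma coeff_meixnerPoly_self (n : ℕ) (a p : ℝ) : (meixnerPoly n a p).coeff n = 1 := by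
  have hlead := (monic_descPochhammer ℝ n).coeff_natDegree
  rw [descPochhammer_natDegree] at hlead
  rw [meixnerPoly, Polynomial.finsetSum_coeff, Finset.sum_range_succ, Finset.sum_eq_zero]
  · simp [hlead]
  · intro k hk
    rw [Polynomial.coeff_C_mul, Polynomial.coeff_eq_zero_of_natDegree_lt, mul_zero]
    rw [descPochhammer_natDegree]
    exact Finset.mem_range.1 hk

lemma natDegree_meixnerPoly (n : ℕ) (a p : ℝ) : (meixnerPoly n a p).natDegree = n :=
  (natDegree_meixnerPoly_le n a p).antisymm
    (Polynomial.le_natDegree_of_ne_zero (by simp [coeff_meixnerPoly_self]))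

lemma monic_meixnerPoly (n : ℕ) (a p : ℝ) : (meixnerPoly n a p).Monic := by
  rw [Polynomial.Monic, Polynomial.leadingCoeff, natDegree_meixnerPoly, coeff_meixnerPoly_self]

/-! ### Orthogonality under the negative binomial law -/

lemma negBinomial_nonneg {a p : ℝ} (ha : 0 ≤ a) (hp0 : 0 ≤ p) (hp1 : p ≤ 1) (k : ℕ) :
    0 ≤ negBinomial a p k := by
  have := ascPochhammer_eval_nonneg ha k
  have : 0 ≤ (1 - p) ^ a := Real.rpow_nonneg (sub_nonneg.2 hp1) _
  unfold negBinomial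
  positivity

lemma negBinomial_add_mul_desc_mul_asc (a p : ℝ) (y k f : ℕ) :
    negBinomial a p (y + k) * ((descPochhammer ℝ k).eval ((y + k : ℕ) : ℝ) *
        (ascPochhammer ℝ f).eval (a + (y + k : ℕ))) =
      p ^ k * (ascPochhammer ℝ (k + f)).eval a * (1 - p) ^ a *
        ((ascPochhammer ℝ y).eval (a + (k + f : ℕ)) * (p ^ y / y.factorial)) := by
  have hasc : (ascPochhammer ℝ (y + k)).eval a * (ascPochhammer ℝ f).eval (a + (y + k : ℕ)) =
      (ascPochhammer ℝ (k + f)).eval a * (ascPochhammer ℝ y).eval (a + (k + f : ℕ)) := by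
    rw [← ascPochhammer_add_eval, ← ascPochhammer_add_eval, add_assoc, add_comm y]
  have hdesc : (descPochhammer ℝ k).eval ((y + k : ℕ) : ℝ) =
      (y + k).factorial / y.factorial := by
    have := Nat.factorial_mul_descFactorial (Nat.le_add_left k y)
    rw [Nat.add_sub_cancel] at this
    rw [descPochhammer_eval_eq_descFactorial, eq_div_iff (by positivity), mul_comm,
      ← Nat.cast_mul, this]
  rw [negBinomial, hdesc]
  calc _ = ((ascPochhammer ℝ (y + k)).eval a * (ascPochhammer ℝ f).eval (a + (y + k : ℕ))) *
        (p ^ (y + k) / y.factorial) * (1 - p) ^ a := by field_simp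
    _ = _ := by rw [hasc, pow_add]; ring

lemma hasSum_negBinomial_mul_desc_mul_asc (a : ℝ) {p : ℝ} (hp : |p| < 1) (k f : ℕ) :
    HasSum (fun x : ℕ => negBinomial a p x *
        ((descPochhammer ℝ k).eval (x : ℝ) * (ascPochhammer ℝ f).eval (a + x)))
      ((p / (1 - p)) ^ k * (ascPochhammer ℝ (k + f)).eval a * (1 - p)⁻¹ ^ f) := by
  have hp' : 0 < 1 - p := sub_pos.2 (abs_lt.1 hp).2
  have hsmall : ∑ x ∈ Finset.range k, negBinomial a p x *
      ((descPochhammer ℝ k).eval (x : ℝ) * (ascPochhammer ℝ f).eval (a + x)) = 0 :=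
    Finset.sum_eq_zero fun x hx => by
      rw [descPochhammer_eval_coe_nat_of_lt (Finset.mem_range.1 hx), zero_mul, mul_zero]
  rw [← hasSum_nat_add_iff' k, hsmall, sub_zero]
  simp only [negBinomial_add_mul_desc_mul_asc]
  convert! (hasSum_ascPochhammer_mul_pow_div (a + (k + f : ℕ)) hp).mul_left
      (p ^ k * (ascPochhammer ℝ (k + f)).eval a * (1 - p) ^ a) using 1
  rw [neg_add, Real.rpow_add hp', Real.rpow_neg hp'.le, Real.rpow_neg hp'.le, Real.rpow_natCast,
    pow_add, div_pow, inv_pow]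
  have := Real.rpow_pos_of_pos hp' a
  field_simp

lemma sum_neg_one_pow_mul_choose_mul_eval_eq_zero (P : ℝ[X]) {n : ℕ} (hP : P.natDegree < n)
    (a : ℝ) :
    ∑ k ∈ Finset.range (n + 1), (-1 : ℝ) ^ (n - k) * n.choose k * P.eval (a + k) = 0 := by
  have h := congrFun (Polynomial.fwdDiff_iter_eq_zero_of_degree_lt hP) a
  rw [fwdDiff_iter_eq_sum_shift] at h
  simpa using h

/-- Since `(a)^(k + f) = (a)^(k) (a + k)^(f)`, the sum over `k` that defines `meixner n` turns into
the `n`-th finite difference of the polynomial `(·)^(f)`, whose degree is `f < n`. -/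
lemma hasSum_negBinomial_mul_meixner_mul_asc (a : ℝ) {p : ℝ} (hp0 : p ≠ 0) (hp : |p| < 1)
    {n f : ℕ} (hf : f < n) :
    HasSum (fun x : ℕ => negBinomial a p x *
        (meixner n x a p * (ascPochhammer ℝ f).eval (a + x))) 0 := by
  have : 1 - p ≠ 0 := (sub_pos.2 (abs_lt.1 hp).2).ne'
  have hq : (1 - 1 / p)⁻¹ = -(p / (1 - p)) := by
    rw [show 1 - 1 / p = -((1 - p) / p) by field_simp; ring, inv_neg, inv_div]
  have hterm (k : ℕ) (hk : k ∈ Finset.range (n + 1)) :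
      ((n.choose k : ℝ) * (1 - 1 / p)⁻¹ ^ (n - k) * (ascPochhammer ℝ (n - k)).eval (a + k)) *
        ((p / (1 - p)) ^ k * (ascPochhammer ℝ (k + f)).eval a * (1 - p)⁻¹ ^ f) =
      ((p / (1 - p)) ^ n * (ascPochhammer ℝ n).eval a * (1 - p)⁻¹ ^ f) *
        ((-1) ^ (n - k) * n.choose k * (ascPochhammer ℝ f).eval (a + k)) := by
    obtain ⟨m, rfl⟩ := Nat.exists_eq_add_of_le (Finset.mem_range_succ_iff.1 hk)
    rw [hq, neg_pow, ascPochhammer_add_eval k f, Nat.add_sub_cancel_left,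
      ascPochhammer_add_eval k m, pow_add]
    ring
  have hvalue := sum_neg_one_pow_mul_choose_mul_eval_eq_zero (ascPochhammer ℝ f)
    (by rwa [ascPochhammer_natDegree]) a
  have h := hasSum_sum (s := Finset.range (n + 1)) fun k _ =>
    (hasSum_negBinomial_mul_desc_mul_asc a hp k f).mul_left
      ((n.choose k : ℝ) * (1 - 1 / p)⁻¹ ^ (n - k) * (ascPochhammer ℝ (n - k)).eval (a + k))
  rw [Finset.sum_congr rfl hterm, ← Finset.mul_sum, hvalue, mul_zero] at h
  refine h.congr_fun fun x => ?_
  rw [meixner_eq_sum_inv_pow, Finset.sum_mul, Finset.mul_sum]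
  exact Finset.sum_congr rfl fun k _ => by ring

lemma hasSum_negBinomial_mul_pow_mul_meixner (a : ℝ) {p : ℝ} (hp0 : p ≠ 0) (hp : |p| < 1)
    {n j : ℕ} (hj : j < n) :
    HasSum (fun x : ℕ => negBinomial a p x * ((x : ℝ) ^ j * meixner n x a p)) 0 := by
  suffices h : ∀ j f : ℕ, f + j < n → HasSum (fun x : ℕ => negBinomial a p x *
      ((x : ℝ) ^ j * (meixner n x a p * (ascPochhammer ℝ f).eval (a + x)))) 0 by
    simpa using h j 0 (by omega)
  intro j
  induction j with
  | zero => exact fun f hf => by simpa using hasSum_negBinomial_mul_meixner_mul_asc a hp0 hp hf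
  | succ j ih =>
    intro f hf
    have h := (ih (f + 1) (by omega)).sub ((ih f (by omega)).mul_left (a + f))
    rw [mul_zero, sub_zero] at h
    convert! h using 2 with x
    rw [ascPochhammer_succ_eval]
    ring

lemma summable_negBinomial_mul_pow {a p : ℝ} (ha : 0 ≤ a) (hp0 : 0 ≤ p) (hp1 : p < 1) (m : ℕ) :
    Summable fun x : ℕ => negBinomial a p x * (x : ℝ) ^ m := by
  have hnonneg := negBinomial_nonneg ha hp0 hp1.le
  refine (hasSum_negBinomial_mul_desc_mul_asc a (abs_lt.2 ⟨by linarith, hp1⟩) 0 m).summable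
    |>.of_nonneg_of_le (fun x => mul_nonneg (hnonneg x) (by positivity)) fun x => ?_
  refine mul_le_mul_of_nonneg_left ?_ (hnonneg x)
  calc (x : ℝ) ^ m ≤ (a + x) ^ m := by gcongr; exact le_add_of_nonneg_left ha
    _ ≤ (ascPochhammer ℝ m).eval (a + x) := pow_le_ascPochhammer_eval (by positivity) m
    _ = _ := by simp

lemma summable_negBinomial_mul_abs_eval {a p : ℝ} (ha : 0 ≤ a) (hp0 : 0 ≤ p) (hp1 : p < 1)
    (P : ℝ[X]) : Summable fun x : ℕ => negBinomial a p x * |P.eval (x : ℝ)| := by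
  have h : Summable fun x : ℕ => negBinomial a p x * P.eval (x : ℝ) := by
    simp only [Polynomial.eval_eq_sum_range, Finset.mul_sum, mul_left_comm (negBinomial a p _)]
    exact summable_sum fun j _ => (summable_negBinomial_mul_pow ha hp0 hp1 j).mul_left _
  simpa only [abs_mul, abs_of_nonneg (negBinomial_nonneg ha hp0 hp1.le _)] using h.abs

/-! ### Weighted intensities -/

section WeightedIntensity

variable {Ω X : Type*} [MeasurableSpace Ω] [MeasurableSpace X] {μ : Measure Ω} {κ : Kernel Ω X}
  {φ : Ω → ℝ} {f : X → ℝ} {C : ℝ}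

/-- The intensity of the random measure `κ`, weighted by the positive part of `φ`. A signed weight
is handled as the difference of the intensities with weights `φ` and `-φ`. -/
def weightedIntensity (μ : Measure Ω) (κ : Kernel Ω X) (φ : Ω → ℝ) : Measure X :=
  κ ∘ₘ μ.withDensity fun ω => ENNReal.ofReal (φ ω)

variable [∀ ω, IsFiniteMeasure (κ ω)]

lemma isFiniteMeasure_weightedIntensity (hφ : Measurable φ)
    (hint : Integrable (fun ω => φ ω * (κ ω).real Set.univ) μ) :
    IsFiniteMeasure (weightedIntensity μ κ φ) := by
  refine ⟨?_⟩
  rw [weightedIntensity, Measure.bind_apply MeasurableSet.univ κ.measurable.aemeasurable,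
    lintegral_withDensity_eq_lintegral_mul _ hφ.ennreal_ofReal
      (κ.measurable_coe MeasurableSet.univ)]
  convert hint.lintegral_lt_top using 2
  ext ω
  rw [Pi.mul_apply, ENNReal.ofReal_mul' measureReal_nonneg, ofReal_measureReal]

lemma integrable_mul_integral_kernel (hφ : Measurable φ)
    (hint : Integrable (fun ω => φ ω * (κ ω).real Set.univ) μ)
    (hf : Measurable f) (hC : ∀ x, |f x| ≤ C) :
    Integrable (fun ω => φ ω * ∫ x, f x ∂κ ω) μ := by
  refine (hint.norm.const_mul C).mono'
    (hφ.mul hf.stronglyMeasurable.integral_kernel.measurable).aestronglyMeasurable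
    (.of_forall fun ω => ?_)
  rw [norm_mul, norm_mul, Real.norm_of_nonneg measureReal_nonneg, mul_left_comm]
  exact mul_le_mul_of_nonneg_left (norm_integral_le_of_norm_le_const (.of_forall hC))
    (norm_nonneg _)

lemma integral_weightedIntensity (hφ : Measurable φ)
    (hint : Integrable (fun ω => φ ω * (κ ω).real Set.univ) μ)
    (hf : Measurable f) (hC : ∀ x, |f x| ≤ C) :
    ∫ x, f x ∂weightedIntensity μ κ φ = ∫ ω, max (φ ω) 0 * ∫ x, f x ∂κ ω ∂μ := by
  have : IsFiniteMeasure (weightedIntensity μ κ φ) := isFiniteMeasure_weightedIntensity hφ hint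
  have hfi : Integrable f (weightedIntensity μ κ φ) :=
    .of_bound hf.aestronglyMeasurable C (.of_forall hC)
  rw [weightedIntensity, Measure.comp_eq_comp_const_apply] at hfi ⊢
  rw [Kernel.integral_comp hfi, Kernel.const_apply, integral_withDensity_eq_integral_toReal_smul
    hφ.ennreal_ofReal (.of_forall fun ω => ENNReal.ofReal_lt_top)]
  simp only [ENNReal.toReal_ofReal', smul_eq_mul]

lemma integral_weightedIntensity_sub (hφ : Measurable φ)
    (hint : Integrable (fun ω => φ ω * (κ ω).real Set.univ) μ)
    (hf : Measurable f) (hC : ∀ x, |f x| ≤ C) :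
    ∫ x, f x ∂weightedIntensity μ κ φ - ∫ x, f x ∂weightedIntensity μ κ (-φ) =
      ∫ ω, φ ω * ∫ x, f x ∂κ ω ∂μ := by
  have hneg : Integrable (fun ω => (-φ) ω * (κ ω).real Set.univ) μ := by
    simpa only [Pi.neg_apply, neg_mul] using hint.fun_neg
  have hpos {ψ : Ω → ℝ} (hψ : Measurable ψ)
      (h : Integrable (fun ω => ψ ω * (κ ω).real Set.univ) μ) :
      Integrable (fun ω => max (ψ ω) 0 * ∫ x, f x ∂κ ω) μ := by
    refine integrable_mul_integral_kernel (hψ.max measurable_const) ?_ hf hC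
    simpa only [max_mul_of_nonneg _ _ measureReal_nonneg, zero_mul] using h.pos_part
  rw [integral_weightedIntensity hφ hint hf hC, integral_weightedIntensity hφ.neg hneg hf hC,
    ← integral_sub (hpos hφ hint) (hpos hφ.neg hneg)]
  simp only [← sub_mul, Pi.neg_apply, max_zero_sub_max_neg_zero_eq_self]

lemma integral_mul_integral_kernel_eq_zero (hφ : Measurable φ)
    (hint : Integrable (fun ω => φ ω * (κ ω).real Set.univ) μ) {S : Set (Set X)}
    (hS : ‹MeasurableSpace X› = MeasurableSpace.generateFrom S) (hpi : IsPiSystem S)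
    (huniv : Set.univ ∈ S) (hzero : ∀ s ∈ S, ∫ ω, φ ω * (κ ω).real s ∂μ = 0)
    (hf : Measurable f) (hC : ∀ x, |f x| ≤ C) :
    ∫ ω, φ ω * ∫ x, f x ∂κ ω ∂μ = 0 := by
  have hneg : Integrable (fun ω => (-φ) ω * (κ ω).real Set.univ) μ := by
    simpa only [Pi.neg_apply, neg_mul] using hint.fun_neg
  have := isFiniteMeasure_weightedIntensity hφ hint
  have := isFiniteMeasure_weightedIntensity hφ.neg hneg
  have heq : ∀ s ∈ S, weightedIntensity μ κ φ s = weightedIntensity μ κ (-φ) s := by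
    intro s hs
    have hsm : MeasurableSet s := hS ▸ MeasurableSpace.measurableSet_generateFrom hs
    have h := integral_weightedIntensity_sub hφ hint
      (f := s.indicator 1) (measurable_one.indicator hsm) (C := 1) fun x => by
        by_cases hx : x ∈ s <;> simp [hx]
    simp only [integral_indicator_one hsm, hzero s hs, sub_eq_zero] at h
    exact (measureReal_eq_measureReal_iff).1 h
  rw [← integral_weightedIntensity_sub hφ hint hf hC,
    ext_of_generate_finite S hS hpi heq (heq _ huniv), sub_self]

end WeightedIntensity

section Configurations

variable {E : Type*} [MeasurableSpace E]

/-! ### Counting variables -/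

lemma measurable_meas {B : Set E} (hB : MeasurableSet B) :
    Measurable fun η : Conf E => η.meas B :=
  Measurable.mono (comap_measurable _) (le_iSup₂_of_le B hB le_rfl) le_rfl

lemma measurable_measReal {B : Set E} (hB : MeasurableSet B) :
    Measurable fun η : Conf E => η.meas.real B :=
  (measurable_meas hB).ennreal_toReal

/-- The number of points of `η` in `B`, as a natural number. -/
def count (B : Set E) (η : Conf E) : ℕ := ⌊η.meas.real B⌋₊

lemma count_eq_iff {B : Set E} (hB : MeasurableSet B) (η : Conf E) (k : ℕ) :
    count B η = k ↔ η.meas B = k := by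
  obtain ⟨m, hm⟩ := η.isCount B hB
  simp [count, measureReal_def, hm]

lemma natCast_count {B : Set E} (hB : MeasurableSet B) (η : Conf E) :
    (count B η : ℝ) = η.meas.real B := by
  rw [measureReal_def, (count_eq_iff hB η _).1 rfl, ENNReal.toReal_natCast]

lemma measurable_count {B : Set E} (hB : MeasurableSet B) : Measurable (count B) :=
  Nat.measurable_floor.comp (measurable_measReal hB)

section Law

variable {α : Measure E} {p : ℝ} {ρ : Measure (Conf E)} {B : Set E}

lemma IsPascal.map_count (hρ : IsPascal α p ρ) (hB : MeasurableSet B) :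
    ρ.map (count B) = Measure.sum fun k : ℕ =>
      ENNReal.ofReal (negBinomial (α.real B) p k) • Measure.dirac k := by
  rw [← Measure.sum_smul_dirac (ρ.map (count B))]
  congr! with k
  rw [Measure.map_apply (measurable_count hB) (measurableSet_singleton k), ← hρ.law B hB k]
  simp only [Set.preimage, Set.mem_singleton_iff, count_eq_iff hB]

lemma IsPascal.integrable_comp (hρ : IsPascal α p ρ) (hp0 : 0 ≤ p) (hp1 : p ≤ 1)
    (hB : MeasurableSet B) {g : ℝ → ℝ}
    (hs : Summable fun k : ℕ => negBinomial (α.real B) p k * |g k|) :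
    Integrable (fun η => g (η.meas.real B)) ρ := by
  have h : Integrable (fun k : ℕ => g k) (ρ.map (count B)) := by
    rw [hρ.map_count hB]
    refine integrable_sum_dirac (fun k => ENNReal.ofReal_ne_top) ?_
    simpa [ENNReal.toReal_ofReal (negBinomial_nonneg measureReal_nonneg hp0 hp1 _)] using hs
  simpa only [Function.comp_def, natCast_count hB] using
    h.comp_measurable (measurable_count hB)

lemma IsPascal.integral_comp (hρ : IsPascal α p ρ) (hp0 : 0 ≤ p) (hp1 : p ≤ 1)
    (hB : MeasurableSet B) (g : ℝ → ℝ) :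
    ∫ η, g (η.meas.real B) ∂ρ = ∑' k : ℕ, negBinomial (α.real B) p k * g k := by
  have h : ∫ k : ℕ, g k ∂(ρ.map (count B)) = ∑' k : ℕ, negBinomial (α.real B) p k * g k := by
    rw [hρ.map_count hB, integral_sum_dirac fun k => ENNReal.ofReal_ne_top]
    simp [ENNReal.toReal_ofReal (negBinomial_nonneg measureReal_nonneg hp0 hp1 _)]
  rw [← h, integral_map (measurable_count hB).aemeasurable
    (measurable_of_countable _).aestronglyMeasurable]
  simp only [natCast_count hB]

lemma IsPascal.integral_pow_mul_meixner (hρ : IsPascal α p ρ) (hp0 : 0 < p) (hp1 : p < 1)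
    (hB : MeasurableSet B) {n j : ℕ} (hj : j < n) :
    ∫ η, η.meas.real B ^ j * meixner n (η.meas.real B) (α.real B) p ∂ρ = 0 := by
  rw [hρ.integral_comp hp0.le hp1.le hB fun x => x ^ j * meixner n x (α.real B) p]
  exact (hasSum_negBinomial_mul_pow_mul_meixner _ hp0.ne' (by rwa [abs_of_pos hp0]) hj).tsum_eq

end Law

/-! ### Functionals of polynomial growth -/

variable (E) in
/-- The measurable functionals of a configuration that are bounded by a power of its total mass.
The bound uses `1 + η univ ≥ 1`, so that its powers increase with the exponent. -/
def polyGrowth : Subalgebra ℝ (Conf E → ℝ) where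
  carrier := {F | Measurable F ∧ ∃ (C : ℝ) (m : ℕ), ∀ η, |F η| ≤ C * (1 + η.meas.real Set.univ) ^ m}
  mul_mem' := by
    rintro F G ⟨hFm, C, m, hF⟩ ⟨hGm, D, l, hG⟩
    refine ⟨hFm.mul hGm, C * D, m + l, fun η => ?_⟩
    rw [Pi.mul_apply, abs_mul, pow_add, mul_mul_mul_comm]
    exact mul_le_mul (hF η) (hG η) (abs_nonneg _) ((abs_nonneg _).trans (hF η))
  add_mem' := by
    rintro F G ⟨hFm, C, m, hF⟩ ⟨hGm, D, l, hG⟩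
    refine ⟨hFm.add hGm, |C| + |D|, max m l, fun η => ?_⟩
    have hN : 1 ≤ 1 + η.meas.real Set.univ := le_add_of_nonneg_right measureReal_nonneg
    calc |F η + G η| ≤ |F η| + |G η| := abs_add_le _ _
      _ ≤ |C| * (1 + η.meas.real Set.univ) ^ m + |D| * (1 + η.meas.real Set.univ) ^ l := by
        gcongr
        · exact (hF η).trans (by gcongr; exact le_abs_self C)
        · exact (hG η).trans (by gcongr; exact le_abs_self D)
      _ ≤ _ := by
        rw [add_mul]
        gcongr
        · exact le_max_left m l
        · exact le_max_right m l
  algebraMap_mem' c := ⟨measurable_const, |c|, 0, fun η => by simp⟩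

lemma measurable_of_mem_polyGrowth {F : Conf E → ℝ} (hF : F ∈ polyGrowth E) : Measurable F := hF.1

lemma measReal_mem_polyGrowth {B : Set E} (hB : MeasurableSet B) :
    (fun η : Conf E => η.meas.real B) ∈ polyGrowth E := by
  refine ⟨measurable_measReal hB, 1, 1, fun η => ?_⟩
  rw [abs_of_nonneg measureReal_nonneg, pow_one, one_mul]
  exact (measureReal_mono (Set.subset_univ B)).trans (le_add_of_nonneg_left zero_le_one)

lemma eval_comp_mem_polyGrowth {F : Conf E → ℝ} (hF : F ∈ polyGrowth E) (P : ℝ[X]) :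
    (fun η => P.eval (F η)) ∈ polyGrowth E := by
  have h : (fun η => P.eval (F η)) = Polynomial.aeval F P := by
    ext η
    simp
  rw [h]
  exact Algebra.adjoin_le (Set.singleton_subset_iff.2 hF)
    (Polynomial.aeval_mem_adjoin_singleton ℝ F)

lemma mvPolynomial_eval_mem_polyGrowth {T : Type*} {F : T → Conf E → ℝ}
    (hF : ∀ t, F t ∈ polyGrowth E) (q : MvPolynomial T ℝ) :
    (fun η => q.eval fun t => F t η) ∈ polyGrowth E := by
  have h : (fun η => q.eval fun t => F t η) = MvPolynomial.aeval F q := by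
    ext η
    change _ = Pi.evalAlgHom ℝ (fun _ => ℝ) η (MvPolynomial.aeval F q)
    rw [MvPolynomial.comp_aeval_apply, MvPolynomial.aeval_eq_eval]
    rfl
  rw [h]
  refine Algebra.adjoin_le (Set.range_subset_iff.2 hF) ?_
  rw [Algebra.adjoin_range_eq_range_aeval]
  exact ⟨q, rfl⟩

lemma prod_mem_polyGrowth {ι : Type*} (s : Finset ι) {F : ι → Conf E → ℝ}
    (hF : ∀ i ∈ s, F i ∈ polyGrowth E) : (fun η => ∏ i ∈ s, F i η) ∈ polyGrowth E := by
  simpa only [Finset.prod_fn] using prod_mem hF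

lemma meixner_mem_polyGrowth (n : ℕ) (a p : ℝ) {B : Set E} (hB : MeasurableSet B) :
    (fun η : Conf E => meixner n (η.meas.real B) a p) ∈ polyGrowth E := by
  simpa only [eval_meixnerPoly] using
    eval_comp_mem_polyGrowth (measReal_mem_polyGrowth hB) (meixnerPoly n a p)

/-- All moments of the total mass are finite. They are taken of `1 + η univ`, the quantity that
controls `polyGrowth`. -/
def HasMoments (ρ : Measure (Conf E)) : Prop :=
  ∀ m : ℕ, Integrable (fun η : Conf E => (1 + η.meas.real Set.univ) ^ m) ρ

lemma IsPascal.hasMoments {α : Measure E} {p : ℝ} {ρ : Measure (Conf E)} (hρ : IsPascal α p ρ)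
    (hp0 : 0 ≤ p) (hp1 : p < 1) : HasMoments ρ := by
  intro m
  have h := summable_negBinomial_mul_abs_eval (a := α.real Set.univ) measureReal_nonneg hp0 hp1
    ((1 + Polynomial.X) ^ m)
  simp only [Polynomial.eval_pow, Polynomial.eval_add, Polynomial.eval_one,
    Polynomial.eval_X] at h
  exact hρ.integrable_comp hp0 hp1.le MeasurableSet.univ (g := fun x => (1 + x) ^ m) h

lemma HasMoments.integrable {ρ : Measure (Conf E)} (hρ : HasMoments ρ) {F : Conf E → ℝ}
    (hF : F ∈ polyGrowth E) : Integrable F ρ := by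
  obtain ⟨hFm, C, m, hF⟩ := hF
  exact ((hρ m).const_mul C).mono' hFm.aestronglyMeasurable (.of_forall hF)

lemma HasMoments.memLp_two {ρ : Measure (Conf E)} (hρ : HasMoments ρ) {F : Conf E → ℝ}
    (hF : F ∈ polyGrowth E) : MemLp F 2 ρ :=
  (memLp_two_iff_integrable_sq hF.1.aestronglyMeasurable).2 (hρ.integrable (pow_mem hF 2))

/-! ### Monomials -/

section Monomials

variable {n : ℕ}

variable (E) in
/-- The product measure `η^{⊗n}` as a kernel, so that `monomial f η` is an integral of `f` against
it. -/
def powKernel (n : ℕ) : Kernel (Conf E) (Fin n → E) where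
  toFun η := Measure.pi fun _ => η.meas
  measurable' := by
    refine Measurable.measure_of_isPiSystem generateFrom_pi.symm isPiSystem_pi ?_ ?_
    · rintro _ ⟨A, hA, rfl⟩
      simp only [Measure.pi_pi]
      exact Finset.measurable_fun_prod _ fun i _ => measurable_meas (hA i (Set.mem_univ i))
    · simp only [Measure.pi_univ]
      exact Finset.measurable_fun_prod _ fun i _ => measurable_meas MeasurableSet.univ

instance (η : Conf E) : IsFiniteMeasure (powKernel E n η) :=
  inferInstanceAs (IsFiniteMeasure (Measure.pi fun _ : Fin n => η.meas))

lemma monomial_eq_integral_powKernel (f : (Fin n → E) → ℝ) (η : Conf E) :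
    monomial f η = ∫ x, f x ∂powKernel E n η := rfl

lemma powKernel_real_pi (A : Fin n → Set E) (η : Conf E) :
    (powKernel E n η).real (Set.univ.pi A) = ∏ i, η.meas.real (A i) := by
  change (Measure.pi fun _ => η.meas).real (Set.univ.pi A) = _
  rw [measureReal_def, Measure.pi_pi, ENNReal.toReal_prod]
  rfl

lemma powKernel_real_univ (η : Conf E) :
    (powKernel E n η).real Set.univ = η.meas.real Set.univ ^ n := by
  rw [← Set.pi_univ, powKernel_real_pi, Finset.prod_const, Finset.card_univ, Fintype.card_fin]

lemma monomial_mem_polyGrowth {f : (Fin n → E) → ℝ} (hf : Measurable f) {C : ℝ}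
    (hC : ∀ x, |f x| ≤ C) : monomial f ∈ polyGrowth E := by
  refine ⟨(hf.stronglyMeasurable.integral_kernel (κ := powKernel E n)).measurable, |C|, n,
    fun η => ?_⟩
  calc |monomial f η| = ‖∫ x, f x ∂powKernel E n η‖ := rfl
    _ ≤ |C| * (powKernel E n η).real Set.univ :=
      norm_integral_le_of_norm_le_const (.of_forall fun x => (hC x).trans (le_abs_self C))
    _ ≤ |C| * (1 + η.meas.real Set.univ) ^ n := by
      rw [powKernel_real_univ]
      gcongr
      exact le_add_of_nonneg_left zero_le_one

lemma polyDegLT_le_polyGrowth (n : ℕ) :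
    polyDegLT E n ≤ Subalgebra.toSubmodule (polyGrowth E) := by
  refine Submodule.span_le.2 ?_
  rintro _ ⟨k, -, f, hf, ⟨C, hC⟩, rfl⟩
  exact monomial_mem_polyGrowth hf hC

lemma HasMoments.integral_mul_monomial_eq_zero {ρ : Measure (Conf E)} (hρ : HasMoments ρ)
    {Φ : Conf E → ℝ} (hΦ : Φ ∈ polyGrowth E)
    (hbox : ∀ A : Fin n → Set E, (∀ i, MeasurableSet (A i)) →
      ∫ η, Φ η * ∏ i, η.meas.real (A i) ∂ρ = 0)
    {f : (Fin n → E) → ℝ} (hf : Measurable f) {C : ℝ} (hC : ∀ x, |f x| ≤ C) :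
    ∫ η, Φ η * monomial f η ∂ρ = 0 := by
  have hint : Integrable (fun η => Φ η * (powKernel E n η).real Set.univ) ρ := by
    simp only [powKernel_real_univ]
    exact hρ.integrable (mul_mem hΦ (pow_mem (measReal_mem_polyGrowth MeasurableSet.univ) n))
  refine integral_mul_integral_kernel_eq_zero (measurable_of_mem_polyGrowth hΦ) hint
    generateFrom_pi.symm isPiSystem_pi ⟨fun _ => Set.univ, by simp⟩ ?_ hf hC
  rintro _ ⟨A, hA, rfl⟩
  simpa only [powKernel_real_pi] using hbox A fun i => hA i (Set.mem_univ i)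

lemma HasMoments.integral_mul_eq_zero_of_mem_polyDegLT {ρ : Measure (Conf E)} (hρ : HasMoments ρ)
    {Φ : Conf E → ℝ} (hΦ : Φ ∈ polyGrowth E)
    (hbox : ∀ k < n, ∀ A : Fin k → Set E, (∀ i, MeasurableSet (A i)) →
      ∫ η, Φ η * ∏ i, η.meas.real (A i) ∂ρ = 0)
    {q : Conf E → ℝ} (hq : q ∈ polyDegLT E n) : ∫ η, Φ η * q η ∂ρ = 0 := by
  have hint {r : Conf E → ℝ} (hr : r ∈ polyDegLT E n) : Integrable (fun η => Φ η * r η) ρ :=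
    hρ.integrable (mul_mem hΦ (polyDegLT_le_polyGrowth n hr))
  induction hq using Submodule.span_induction with
  | mem q hq =>
    obtain ⟨k, hk, f, hf, ⟨C, hC⟩, rfl⟩ := hq
    exact hρ.integral_mul_monomial_eq_zero hΦ (hbox k hk) hf hC
  | zero => simp
  | add q r hq hr ihq ihr =>
    simp only [Pi.add_apply, mul_add]
    rw [integral_add (hint hq) (hint hr), ihq, ihr, add_zero]
  | smul c q _ ih =>
    simp only [Pi.smul_apply, smul_eq_mul, mul_left_comm _ c]
    rw [integral_const_mul, ih, mul_zero]

end Monomials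

/-! ### Leading terms -/

section TensorIndicator

variable {N : ℕ} (d : Fin N → ℕ)

lemma tensorIndicator_eq_indicator_pi {X : Type*} (B : Fin N → Set X) :
    tensorIndicator B d = (Set.univ.pi fun i => B (finSigmaFinEquiv.symm i).1).indicator 1 := by
  ext x
  rw [← Finset.coe_univ, Set.indicator_pi_one_apply, ← Equiv.prod_comp finSigmaFinEquiv,
    Fintype.prod_sigma]
  simp only [tensorIndicator, Equiv.symm_apply_apply, Pi.one_def]

lemma abs_tensorIndicator_le_one {X : Type*} (B : Fin N → Set X) (x : Fin (∑ k, d k) → X) :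
    |tensorIndicator B d x| ≤ 1 := by
  classical
  rw [tensorIndicator_eq_indicator_pi, Set.indicator_apply]
  split_ifs <;> simp

variable {B : Fin N → Set E} (hB : ∀ k, MeasurableSet (B k))
include hB

lemma measurable_tensorIndicator : Measurable (tensorIndicator B d) := by
  rw [tensorIndicator_eq_indicator_pi]
  exact measurable_one.indicator (MeasurableSet.univ_pi fun i => hB _)

lemma monomial_tensorIndicator (η : Conf E) :
    monomial (tensorIndicator B d) η = ∏ k, η.meas.real (B k) ^ d k := by
  rw [tensorIndicator_eq_indicator_pi, monomial_eq_integral_powKernel,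
    integral_indicator_one (MeasurableSet.univ_pi fun i => hB _), powKernel_real_pi,
    ← Equiv.prod_comp finSigmaFinEquiv, Fintype.prod_sigma]
  simp

lemma monomial_tensorIndicator_mem_polyGrowth :
    (monomial (tensorIndicator B d) : Conf E → ℝ) ∈ polyGrowth E :=
  monomial_mem_polyGrowth (measurable_tensorIndicator d hB) (abs_tensorIndicator_le_one d B)

lemma monomial_tensorIndicator_mem_polyDegLT {n : ℕ} (hd : ∑ k, d k < n) :
    (monomial (tensorIndicator B d) : Conf E → ℝ) ∈ polyDegLT E n :=
  Submodule.subset_span ⟨_, hd, _, measurable_tensorIndicator d hB,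
    ⟨1, abs_tensorIndicator_le_one d B⟩, rfl⟩

lemma monomial_sub_prod_eval_mem_polyDegLT {P : Fin N → ℝ[X]} (hmonic : ∀ k, (P k).Monic)
    (hdeg : ∀ k, (P k).natDegree = d k) :
    (fun η : Conf E => monomial (tensorIndicator B d) η -
      ∏ k, (P k).eval (η.meas.real (B k))) ∈ polyDegLT E (∑ k, d k) := by
  let S : Finset (Fin N → ℕ) := Fintype.piFinset fun k => Finset.range (d k + 1)
  have hdS : d ∈ S := by simp [S]
  have hlead : ∏ k, (P k).coeff (d k) = 1 :=
    Finset.prod_eq_one fun k _ => by rw [← hdeg k, (hmonic k).coeff_natDegree]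
  have hprod (η : Conf E) : ∏ k, (P k).eval (η.meas.real (B k)) =
      monomial (tensorIndicator B d) η +
        ∑ e ∈ S.erase d, (∏ k, (P k).coeff (e k)) * monomial (tensorIndicator B e) η := by
    simp only [Polynomial.eval_eq_sum_range, hdeg, Finset.prod_univ_sum, Finset.prod_mul_distrib,
      ← monomial_tensorIndicator _ hB]
    rw [← Finset.add_sum_erase S _ hdS, hlead, one_mul]
  have hdiff : (fun η : Conf E => monomial (tensorIndicator B d) η -
      ∏ k, (P k).eval (η.meas.real (B k))) =
      ∑ e ∈ S.erase d, (-∏ k, (P k).coeff (e k)) • monomial (tensorIndicator B e) := by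
    ext η
    simp [hprod]
  rw [hdiff]
  refine Submodule.sum_mem _ fun e he => Submodule.smul_mem _ _
    (monomial_tensorIndicator_mem_polyDegLT e hB ?_)
  obtain ⟨hne, heS⟩ := Finset.mem_erase.1 he
  have hle : e ≤ d := fun k =>
    Nat.lt_succ_iff.1 (Finset.mem_range.1 (Fintype.mem_piFinset.1 heS k))
  exact Fintype.sum_strictMono (hle.lt_of_ne hne)

end TensorIndicator

/-! ### Orthogonality of products of Meixner polynomials -/

section Orthogonality

variable {α : Measure E} {p : ℝ} {ρ : Measure (Conf E)}

lemma IsPascal.iIndepFun_meas (hρ : IsPascal α p ρ) {T : Type*} [Finite T] {C : T → Set E}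
    (hC : ∀ t, MeasurableSet (C t)) (hdisj : Pairwise (Function.onFun Disjoint C)) :
    iIndepFun (fun t (η : Conf E) => η.meas (C t)) ρ := by
  let e := Finite.equivFin T
  have h := hρ.indep (Nat.card T) (fun i => C (e.symm i)) (fun i => hC _)
    fun i j hij => hdisj (e.symm.injective.ne hij)
  simpa using h.precomp e.injective

lemma IsPascal.integral_prod_eval (hρ : IsPascal α p ρ) {T : Type*} [Fintype T] {C : T → Set E}
    (hC : ∀ t, MeasurableSet (C t)) (hdisj : Pairwise (Function.onFun Disjoint C))
    (P : T → ℝ[X]) :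
    ∫ η, ∏ t, (P t).eval (η.meas.real (C t)) ∂ρ =
      ∏ t, ∫ η, (P t).eval (η.meas.real (C t)) ∂ρ :=
  (hρ.iIndepFun_meas hC hdisj).integral_fun_prod_comp
    (f := fun t (x : ENNReal) => (P t).eval x.toReal)
    (fun t => (measurable_meas (hC t)).aemeasurable)
    fun t => ((P t).continuous.measurable.comp ENNReal.measurable_toReal).aestronglyMeasurable

lemma IsPascal.integral_prod_pow_mul_prod_meixner (hρ : IsPascal α p ρ) (hp0 : 0 < p)
    (hp1 : p < 1) {T : Type*} [Fintype T] {C : T → Set E} (hC : ∀ t, MeasurableSet (C t))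
    (hdisj : Pairwise (Function.onFun Disjoint C)) {m e : T → ℕ} (hme : ∑ t, m t < ∑ t, e t) :
    ∫ η, (∏ t, η.meas.real (C t) ^ m t) *
      ∏ t, meixner (e t) (η.meas.real (C t)) (α.real (C t)) p ∂ρ = 0 := by
  obtain ⟨t, -, ht⟩ := Finset.exists_lt_of_sum_lt hme
  have hsplit := hρ.integral_prod_eval hC hdisj fun t =>
    Polynomial.X ^ m t * meixnerPoly (e t) (α.real (C t)) p
  simp only [Polynomial.eval_mul, Polynomial.eval_pow, Polynomial.eval_X, eval_meixnerPoly,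
    Finset.prod_mul_distrib] at hsplit
  rw [hsplit]
  exact Finset.prod_eq_zero (Finset.mem_univ t)
    (hρ.integral_pow_mul_meixner hp0 hp1 (hC t) ht)

lemma IsPascal.integral_eval_mul_prod_meixner (hρ : IsPascal α p ρ) (hp0 : 0 < p) (hp1 : p < 1)
    {T : Type*} [Fintype T] {C : T → Set E} (hC : ∀ t, MeasurableSet (C t))
    (hdisj : Pairwise (Function.onFun Disjoint C)) {e : T → ℕ} {q : MvPolynomial T ℝ}
    (hq : q.totalDegree < ∑ t, e t) :
    ∫ η, q.eval (fun t => η.meas.real (C t)) *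
      ∏ t, meixner (e t) (η.meas.real (C t)) (α.real (C t)) p ∂ρ = 0 := by
  simp only [MvPolynomial.eval_eq', Finset.sum_mul, mul_assoc]
  rw [integral_finsetSum _ fun m _ => ?_]
  · refine Finset.sum_eq_zero fun m hm => ?_
    rw [integral_const_mul, hρ.integral_prod_pow_mul_prod_meixner hp0 hp1 hC hdisj, mul_zero]
    exact ((Finsupp.sum_fintype m (fun _ k => k) fun _ => rfl).symm.trans_le
      (MvPolynomial.le_totalDegree hm)).trans_lt hq
  · exact ((hρ.hasMoments hp0.le hp1).integrable (mul_mem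
      (prod_mem_polyGrowth _ fun t _ => pow_mem (measReal_mem_polyGrowth (hC t)) _)
      (prod_mem_polyGrowth _ fun t _ => meixner_mem_polyGrowth _ _ _ (hC t)))).const_mul _

lemma IsPascal.integral_eval_mul_prod_meixner_sum (hρ : IsPascal α p ρ) (hp0 : 0 < p)
    (hp1 : p < 1) {ι U : Type*} [Fintype ι] [Fintype U] {C : ι × U → Set E}
    (hC : ∀ t, MeasurableSet (C t)) (hdisj : Pairwise (Function.onFun Disjoint C)) {d : ι → ℕ}
    {q : MvPolynomial (ι × U) ℝ} (hq : q.totalDegree < ∑ i, d i) :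
    ∫ η, q.eval (fun t => η.meas.real (C t)) *
      ∏ i, meixner (d i) (∑ u, η.meas.real (C (i, u))) (∑ u, α.real (C (i, u))) p ∂ρ = 0 := by
  classical
  have hexpand (η : Conf E) := prod_meixner_sum d p (fun t => α.real (C t))
    fun t => η.meas.real (C t)
  simp only [hexpand, Finset.mul_sum, mul_left_comm]
  rw [integral_finsetSum _ fun l _ => ?_]
  · refine Finset.sum_eq_zero fun l hl => ?_
    rw [integral_const_mul, hρ.integral_eval_mul_prod_meixner hp0 hp1 hC hdisj, mul_zero]
    rw [Fintype.sum_prod_type]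
    refine hq.trans_eq (Finset.sum_congr rfl fun i _ => ?_)
    exact (Finset.mem_finsuppAntidiag.1 (Fintype.mem_piFinset.1 hl i)).1.symm
  · exact ((hρ.hasMoments hp0.le hp1).integrable (mul_mem
      (mvPolynomial_eval_mem_polyGrowth (fun t => measReal_mem_polyGrowth (hC t)) q)
      (prod_mem_polyGrowth _ fun t _ => meixner_mem_polyGrowth _ _ _ (hC t)))).const_mul _

lemma exists_measurable_preimage_some_eq {X ι : Type*} [MeasurableSpace X] [Countable ι]
    {B : ι → Set X} (hB : ∀ i, MeasurableSet (B i))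
    (hdisj : Pairwise (Function.onFun Disjoint B)) :
    ∃ f : X → Option ι, Measurable[_, ⊤] f ∧ ∀ i, f ⁻¹' {some i} = B i := by
  classical
  let f : X → Option ι := fun x => if h : ∃ i, x ∈ B i then some h.choose else none
  have hsome (i : ι) : f ⁻¹' {some i} = B i := by
    ext x
    simp only [f, Set.mem_preimage, Set.mem_singleton_iff, Option.dite_none_right_eq_some,
      Option.some.injEq]
    refine ⟨fun ⟨h, hi⟩ => hi ▸ h.choose_spec, fun hx => ⟨⟨i, hx⟩, ?_⟩⟩
    have hchoose := Exists.choose_spec (⟨i, hx⟩ : ∃ i, x ∈ B i)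
    by_contra hne
    exact Set.disjoint_left.1 (hdisj hne) hchoose hx
  have hnone : f ⁻¹' {none} = (⋃ i, B i)ᶜ := by
    ext x
    simp [f]
  let _ : MeasurableSpace (Option ι) := ⊤
  refine ⟨f, measurable_to_countable' fun o => ?_, hsome⟩
  cases o with
  | none => exact hnone ▸ (MeasurableSet.iUnion hB).compl
  | some i => exact (hsome i).symm ▸ hB i

lemma IsPascal.integral_eval_mul_prod_meixner_fiber [IsFiniteMeasure α] (hρ : IsPascal α p ρ)
    (hp0 : 0 < p) (hp1 : p < 1) {ι U : Type*} [Fintype ι] [Finite U] {τ : E → ι × U}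
    (hτ : ∀ t, MeasurableSet (τ ⁻¹' {t})) {d : ι → ℕ} {q : MvPolynomial (ι × U) ℝ}
    (hq : q.totalDegree < ∑ i, d i) :
    ∫ η, q.eval (fun t => η.meas.real (τ ⁻¹' {t})) *
      ∏ i, meixner (d i) (η.meas.real {x | (τ x).1 = i}) (α.real {x | (τ x).1 = i}) p ∂ρ = 0 := by
  classical
  have := Fintype.ofFinite U
  have hfiber (μ : Measure E) [IsFiniteMeasure μ] (i : ι) :
      μ.real {x | (τ x).1 = i} = ∑ u, μ.real (τ ⁻¹' {(i, u)}) := by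
    have h := sum_measureReal_preimage_singleton (μ := μ) ({i} ×ˢ Finset.univ) fun t _ => hτ t
    rw [Finset.sum_product, Finset.sum_singleton] at h
    rw [h]
    congr 1
    ext x
    simp [Prod.ext_iff, eq_comm]
  simp only [hfiber]
  exact hρ.integral_eval_mul_prod_meixner_sum hp0 hp1 hτ (pairwise_disjoint_fiber τ) hq

lemma IsPascal.integral_prod_meixner_mul_prod [IsFiniteMeasure α] (hρ : IsPascal α p ρ)
    (hp0 : 0 < p) (hp1 : p < 1) {ι : Type*} [Fintype ι] {B : ι → Set E}
    (hB : ∀ i, MeasurableSet (B i)) (hdisj : Pairwise (Function.onFun Disjoint B))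
    {d : ι → ℕ} {κ : Type*} [Fintype κ] (hκ : Fintype.card κ < ∑ i, d i)
    {A : κ → Set E} (hA : ∀ j, MeasurableSet (A j)) :
    ∫ η, (∏ i, meixner (d i) (η.meas.real (B i)) (α.real (B i)) p) *
      ∏ j, η.meas.real (A j) ∂ρ = 0 := by
  classical
  obtain ⟨f, hfm, hf⟩ := exists_measurable_preimage_some_eq hB hdisj
  let _ : MeasurableSpace (Option ι) := ⊤
  let τ : E → Option ι × (κ → Prop) := fun x => (f x, fun j => x ∈ A j)
  have hτ : Measurable τ :=
    hfm.prodMk (measurable_pi_lambda _ fun j => measurable_mem.2 (hA j))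
  have hτt (t) : MeasurableSet (τ ⁻¹' {t}) := hτ (measurableSet_singleton t)
  let q : MvPolynomial (Option ι × (κ → Prop)) ℝ :=
    ∏ j, ∑ t with t.2 j, MvPolynomial.X t
  have hq (η : Conf E) :
      q.eval (fun t => η.meas.real (τ ⁻¹' {t})) = ∏ j, η.meas.real (A j) := by
    simp only [q, map_prod, map_sum, MvPolynomial.eval_X]
    refine Finset.prod_congr rfl fun j _ => ?_
    rw [sum_measureReal_preimage_singleton _ fun t _ => hτt t]
    congr 1
    ext x
    simp [τ]
  have hdeg : q.totalDegree ≤ Fintype.card κ := by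
    refine (MvPolynomial.totalDegree_finsetProd _ _).trans ?_
    refine (Finset.sum_le_card_nsmul _ _ 1 fun j _ => ?_).trans_eq (by simp)
    exact MvPolynomial.totalDegree_finsetSum_le fun t _ => (MvPolynomial.totalDegree_X t).le
  have h := hρ.integral_eval_mul_prod_meixner_fiber hp0 hp1 hτt (d := fun o => o.elim 0 d)
    (q := q) (by simpa [Fintype.sum_option] using hdeg.trans_lt hκ)
  have hfB (i : ι) : {x | f x = some i} = B i := hf i
  simpa [hq, Fintype.prod_option, τ, hfB, mul_comm, meixner] using h

end Orthogonality

/-! ### The orthogonal projection -/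

section Projection

variable {ρ : Measure (Conf E)} {n : ℕ} {Φ : Conf E → ℝ}

lemma toLp_mem_polyL2 {q : Conf E → ℝ} (hq : q ∈ polyDegLT E n) (hq2 : MemLp q 2 ρ) :
    hq2.toLp q ∈ polyL2 ρ n :=
  ⟨q, hq, hq2.coeFn_toLp⟩

lemma toLp_mem_orthogonal_closure_polyL2 (hΦ : MemLp Φ 2 ρ)
    (horth : ∀ q ∈ polyDegLT E n, ∫ η, Φ η * q η ∂ρ = 0) :
    hΦ.toLp Φ ∈ (polyL2 ρ n).topologicalClosureᗮ := by
  rw [Submodule.orthogonal_closure, Submodule.mem_orthogonal']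
  rintro G ⟨q, hq, hGq⟩
  rw [L2.inner_def, ← horth q hq]
  refine integral_congr_ae ?_
  filter_upwards [hGq, hΦ.coeFn_toLp] with η hG hΦη
  rw [hG, hΦη]
  simp [mul_comm]

lemma genOrthPoly_eq_toLp {f : (Fin n → E) → ℝ} (hf : MemLp (monomial f) 2 ρ) (hΦ : MemLp Φ 2 ρ)
    (horth : ∀ q ∈ polyDegLT E n, ∫ η, Φ η * q η ∂ρ = 0)
    (hsub : monomial f - Φ ∈ polyDegLT E n) : genOrthPoly ρ f hf = hΦ.toLp Φ := by
  refine Submodule.eq_starProjection_of_mem_orthogonal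
    (toLp_mem_orthogonal_closure_polyL2 hΦ horth) ?_
  rw [← MemLp.toLp_sub]
  exact Submodule.le_orthogonal_orthogonal _
    (Submodule.le_topologicalClosure _ (toLp_mem_polyL2 hsub (hf.sub hΦ)))

end Projection

end Configurations

end PascalMeixner

end

open PascalMeixner in
theorem mainTheorem4_general {E : Type*} [MeasurableSpace E] (α : Measure E) [IsFiniteMeasure α]
    (p : ℝ) (hp0 : 0 < p) (hp1 : p < 1) (ρ : Measure (Conf E)) (hρ : IsPascal α p ρ)
    (N : ℕ) (B : Fin N → Set E) (hB : ∀ k, MeasurableSet (B k))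
    (hdisj : Pairwise (Function.onFun Disjoint B)) (d : Fin N → ℕ) :
    ∃ h : MemLp (monomial (tensorIndicator B d)) 2 ρ,
      ∀ᵐ η ∂ρ, genOrthPoly ρ (tensorIndicator B d) h η =
        ∏ k, meixner (d k) (η.meas.real (B k)) (α.real (B k)) p := by
  have hmom : HasMoments ρ := hρ.hasMoments hp0.le hp1
  let Φ : Conf E → ℝ := fun η => ∏ k, meixner (d k) (η.meas.real (B k)) (α.real (B k)) p
  have hΦ : Φ ∈ polyGrowth E :=
    prod_mem_polyGrowth _ fun k _ => meixner_mem_polyGrowth _ _ _ (hB k)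
  have horth : ∀ q ∈ polyDegLT E (∑ k, d k), ∫ η, Φ η * q η ∂ρ = 0 := fun q hq =>
    hmom.integral_mul_eq_zero_of_mem_polyDegLT hΦ (fun k hk A hA =>
      hρ.integral_prod_meixner_mul_prod hp0 hp1 hB hdisj (by rwa [Fintype.card_fin]) hA) hq
  have hlead : monomial (tensorIndicator B d) - Φ ∈ polyDegLT E (∑ k, d k) := by
    simpa only [eval_meixnerPoly, ← Pi.sub_def] using monomial_sub_prod_eval_mem_polyDegLT d hB
      (fun k => monic_meixnerPoly (d k) (α.real (B k)) p)
      fun k => natDegree_meixnerPoly (d k) (α.real (B k)) p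
  have hmem : MemLp (monomial (tensorIndicator B d)) 2 ρ :=
    hmom.memLp_two (monomial_tensorIndicator_mem_polyGrowth d hB)
  refine ⟨hmem, ?_⟩
  rw [genOrthPoly_eq_toLp hmem (hmom.memLp_two hΦ) horth hlead]
  exact (hmom.memLp_two hΦ).coeFn_toLp

theorem mainTheorem4 {E : Type*} [MeasurableSpace E] [StandardBorelSpace E]
    (α : Measure E) [IsFiniteMeasure α] (p : ℝ) (hp0 : 0 < p) (hp1 : p < 1)
    (ρ : Measure (PascalMeixner.Conf E)) [IsProbabilityMeasure ρ]
    (hρ : PascalMeixner.IsPascal α p ρ)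
    (N : ℕ) (B : Fin N → Set E) (hB : ∀ k, MeasurableSet (B k))
    (hdisj : Pairwise (Function.onFun Disjoint B)) (d : Fin N → ℕ) :
    ∃ h : MemLp (PascalMeixner.monomial (PascalMeixner.tensorIndicator B d)) 2 ρ,
      ∀ᵐ η ∂ρ, PascalMeixner.genOrthPoly ρ (PascalMeixner.tensorIndicator B d) h η =
        ∏ k, PascalMeixner.meixner (d k) (η.meas.real (B k)) (α.real (B k)) p :=
  mainTheorem4_general α p hp0 hp1 ρ hρ N B hB hdisj d
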